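/- Let $R$ be an associative ring with unity; modules and ideals are left modules and left ideals. Let $\gamma(R)$ be the least infinite cardinal $\kappa$ such that every ideal of $R$ is generated by fewer than $\kappa$ elements. A module $M\supseteq N$ is universal over $N$ if $\|M\|=\|N\|$ and every module $N^*\supseteq N$ with $\|N^*\|=\|M\|$ embeds into $M$ by a homomorphism fixing $N$ pointwise. For an infinite cardinal $\lambda$ and a limit ordinal $\alpha<\lambda^+$, a $(\lambda,\alpha)$-limit model is a module $M=\bigcup_{i<\alpha}M_i$, where $(M_i)_{i<\alpha}$ is an increasing continuous chain of modules of cardinality $\lambda$ such that $M_{i+1}$ is universal over $M_i$ for every $i<\alpha$. A $\lambda$-limit model is a $(\lambda,\alpha)$-limit model for some limit ordinal $\alpha<\lambda^+$, and the class of $R$-modules with embeddings is stable in $\lambda$ if there is a $\lambda$-limit model. Let $\operatorname{Reg}$ be the class of regular cardinals, and let $[\aleph_0,\gamma(R))$ be the set of cardinals $\kappa$ with $\aleph_0\le\kappa<\gamma(R)$. **Lemma 3.22.** Let $\lambda\ge\operatorname{card}(R)+\aleph_0$ be a cardinal such that $\lambda\geq\gamma(R)^+$ and the class of $R$-modules with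 embeddings is stable in $\lambda$, and let $A=([\aleph_0,\gamma(R))\cap\operatorname{Reg})\cup\{\gamma(R)^+\}$. For every $\alpha\in A$ there is a $(\lambda,\alpha)$-limit model, and it is unique up to isomorphism. If $\alpha,\beta\in A$ and $\alpha\ne\beta$, then the $(\lambda,\alpha)$-limit model and the $(\lambda,\beta)$-limit model are not isomorphic. Furthermore, every $\lambda$-limit model is isomorphic to the $(\lambda,\alpha)$-limit model for some $\alpha\in A$. -/

import Mathlib

open Cardinal Ordinal

universe u

/-- A left ideal `I` is `(<κ)`-generated: it has a generating set of cardinality less than `κ`.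
(For a not necessarily commutative ring, Mathlib's `Ideal R` is the type of left ideals.) -/
def IsLTGenerated {R : Type u} [Ring R] (κ : Cardinal.{u}) (I : Ideal R) : Prop :=
  ∃ S : Set R, #S < κ ∧ Ideal.span S = I

/-- `γ(R)`: the least infinite cardinal such that every left ideal is `(<γ(R))`-generated. -/
noncomputable def gammaCard (R : Type u) [Ring R] : Cardinal.{u} :=
  sInf {κ : Cardinal.{u} | ℵ₀ ≤ κ ∧ ∀ I : Ideal R, IsLTGenerated κ I}

/-- The infimum defining `γ(R)` is attained. -/
theorem gammaCard_spec (R : Type u) [Ring R] :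
    ℵ₀ ≤ gammaCard R ∧ ∀ I : Ideal R, IsLTGenerated (gammaCard R) I := by
  have hne : {κ : Cardinal.{u} | ℵ₀ ≤ κ ∧ ∀ I : Ideal R, IsLTGenerated κ I}.Nonempty := by
    refine ⟨Order.succ (max ℵ₀ #R), (le_max_left _ _).trans (Order.le_succ _), fun I => ?_⟩
    refine ⟨(I : Set R), ?_, Ideal.span_eq I⟩
    exact Order.lt_succ_of_le ((mk_set_le _).trans (le_max_right _ _))
  exact csInf_mem hne

/-- For an embedding `ι : N → M` (which lets one regard `N` as a submodule of `M`):
`M` is universal over `N`, that is `‖M‖ = ‖N‖` and every extension `j : N → N'` of `N` with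
`‖N'‖ = ‖M‖` embeds into `M` over `N`. -/
def IsUniversalOver {R : Type u} [Ring R] {N M : Type u}
    [AddCommGroup N] [Module R N] [AddCommGroup M] [Module R M] (ι : N →ₗ[R] M) : Prop :=
  Function.Injective ι ∧ #M = #N ∧
    ∀ (N' : Type u) [AddCommGroup N'] [Module R N'] (j : N →ₗ[R] N'),
      Function.Injective j → #N' = #M →
        ∃ f : N' →ₗ[R] M, Function.Injective f ∧ f ∘ₗ j = ι

/-- `M` is a `(μ, α)`-limit model over its submodule `N`. The chain is a family of submodules of
`M` of which only the members with index below `α` matter. -/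
def IsLimitModelOver (R : Type u) [Ring R] (μ : Cardinal.{u}) (α : Ordinal.{u})
    (M : Type u) [AddCommGroup M] [Module R M] (N : Submodule R M) : Prop :=
  ℵ₀ ≤ μ ∧ Order.IsSuccLimit α ∧ α < (Order.succ μ).ord ∧
  ∃ F : Ordinal.{u} → Submodule R M,
    (∀ i < α, #(F i) = μ) ∧
    (∀ i j, i ≤ j → j < α → F i ≤ F j) ∧
    (∀ i < α, Order.IsSuccLimit i → (F i : Set M) = ⋃ j ∈ Set.Iio i, (F j : Set M)) ∧
    F 0 = N ∧
    (Set.univ : Set M) = ⋃ i ∈ Set.Iio α, (F i : Set M) ∧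
    (∀ i < α, ∃ h : F i ≤ F (Order.succ i), IsUniversalOver (Submodule.inclusion h))

/-- `M` is a `(μ, α)`-limit model. -/
def IsLimitModel (R : Type u) [Ring R] (μ : Cardinal.{u}) (α : Ordinal.{u})
    (M : Type u) [AddCommGroup M] [Module R M] : Prop :=
  ∃ N : Submodule R M, IsLimitModelOver R μ α M N

/-- `M` is a `μ`-limit model: a `(μ, α)`-limit model for some limit ordinal `α < μ⁺`. -/
def IsCardLimitModel (R : Type u) [Ring R] (μ : Cardinal.{u})
    (M : Type u) [AddCommGroup M] [Module R M] : Prop :=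
  ∃ α : Ordinal.{u}, IsLimitModel R μ α M

/-- The class of left `R`-modules with embeddings is stable in `μ`: there is a `μ`-limit model. -/
def IsStableIn (R : Type u) [Ring R] (μ : Cardinal.{u}) : Prop :=
  ∃ (M : Type u) (_ : AddCommGroup M) (_ : Module R M), IsCardLimitModel R μ M

/-- The set of cardinals `([ℵ₀, γ(R)) ∩ Reg) ∪ {γ(R)⁺}`. -/
def limitLengths (R : Type u) [Ring R] : Set Cardinal.{u} :=
  (Set.Ico ℵ₀ (gammaCard R) ∩ {κ | κ.IsRegular}) ∪ {Order.succ (gammaCard R)}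

/-! Only the cofinality of the length matters, and only up to `γ(R)`. A cofinal continuous subchain
turns length `α` into length `cof α`, and two limit models of equal length are isomorphic by
back-and-forth along their chains.

If `cof α ≥ γ(R)`, the images of the generators of a left ideal lie in one stage of the chain and
the next stage extends the map, so the limit model is injective by Baer's criterion. Its square is a
limit model of the same length, hence isomorphic to it. Two such models embed into each other, and
Pełczyński's decomposition makes them isomorphic; the regular length `γ(R)⁺` represents them all.

If `κ < γ(R)` is regular, a left ideal with a strictly increasing chain of `κ` subideals carries a
map into the model of length `κ` that escapes every stage, so it does not extend to `R`. In a model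
of larger regular length all maps from `κ`-generated ideals extend, which separates the lengths.

The common tool is amalgamation by pushouts (`IsUniversalOver.exists_extension`), packaged as
`IsExtensibleIn`. Stability provides universal extensions, and iterating them yields limit models of
every length. -/

/-! ### Ordinal-indexed chains and cofinality. -/

/-- Transfinite construction of a continuous increasing chain in a complete lattice. -/
theorem exists_continuous_chain {X : Type*} [CompleteLattice X]
    (P : Ordinal.{u} → X → Prop) (Q : Ordinal.{u} → X → X → Prop) (α : Ordinal.{u}) (x₀ : X)
    (h0 : P 0 x₀)
    (hs : ∀ i, Order.succ i < α → ∀ x, P i x → ∃ y, x ≤ y ∧ P (Order.succ i) y ∧ Q i x y)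
    (hl : ∀ δ < α, Order.IsSuccLimit δ → ∀ x : Ordinal.{u} → X, Monotone x →
      (∀ j < δ, P j (x j)) → P δ (⨆ j : Set.Iio δ, x j)) :
    ∃ x : Ordinal.{u} → X, Monotone x ∧ x 0 = x₀ ∧ (∀ i < α, P i (x i)) ∧
      (∀ i, Order.succ i < α → Q i (x i) (x (Order.succ i))) ∧
      ∀ δ, Order.IsSuccLimit δ → x δ = ⨆ j : Set.Iio δ, x j := by
  classical
  -- The default value `x` keeps the chain monotone on all ordinals, even where no good successor
  -- exists.
  let g : Ordinal.{u} → X → X := fun i x =>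
    if h : ∃ y, x ≤ y ∧ P (Order.succ i) y ∧ Q i x y then h.choose else x
  have hg : ∀ i x, x ≤ g i x := by
    intro i x
    by_cases h : ∃ y, x ≤ y ∧ P (Order.succ i) y ∧ Q i x y
    · simpa only [g, dif_pos h] using h.choose_spec.1
    · simp only [g, dif_neg h]; exact le_rfl
  have hg' : ∀ i x, Order.succ i < α → P i x →
      P (Order.succ i) (g i x) ∧ Q i x (g i x) := by
    intro i x hi hx
    have h := hs i hi x hx
    simpa only [g, dif_pos h] using h.choose_spec.2
  let x : Ordinal.{u} → X := fun i =>
    limitRecOn (motive := fun _ => X) i x₀ g (fun δ _ ih => ⨆ j : Set.Iio δ, ih j.1 j.2)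
  have x0 : x 0 = x₀ := limitRecOn_zero _ _ _
  have xs : ∀ i, x (Order.succ i) = g i (x i) := fun i => limitRecOn_add_one _ _ _ _
  have xl : ∀ δ, Order.IsSuccLimit δ → x δ = ⨆ j : Set.Iio δ, x j :=
    fun δ hδ => limitRecOn_limit _ _ _ _ hδ
  have hmono : Monotone x := by
    intro i j
    induction j using SuccOrder.limitRecOn with
    | isMin j hj => intro hij; rw [hj.eq_of_le hij]
    | succ j _ ih =>
      intro hij
      rcases hij.eq_or_lt with rfl | hlt
      · exact le_rfl
      · exact (ih (Order.lt_succ_iff.1 hlt)).trans ((hg _ _).trans (xs j).ge)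
    | isSuccLimit j hj _ =>
      intro hij
      rcases hij.eq_or_lt with rfl | hlt
      · exact le_rfl
      · rw [xl j hj]
        exact le_iSup (fun k : Set.Iio j => x k) ⟨i, hlt⟩
  have hP : ∀ i < α, P i (x i) := by
    intro i
    induction i using SuccOrder.limitRecOn with
    | isMin j hj =>
      intro _
      obtain rfl : j = 0 := by simpa using hj
      rwa [x0]
    | succ j _ ih =>
      intro hj
      rw [xs]
      exact (hg' j _ hj (ih ((Order.le_succ j).trans_lt hj))).1
    | isSuccLimit j hj ih =>
      intro hjα
      rw [xl j hj]
      exact hl j hjα hj x hmono fun k hk => ih k hk (hk.trans hjα)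
  refine ⟨x, hmono, x0, hP, fun i hi => ?_, xl⟩
  rw [xs]
  exact (hg' i _ hi (hP i ((Order.le_succ i).trans_lt hi))).2

/-- The supremum of fewer than `cof α` ordinals below `α` is below `α`. -/
theorem iSup_Iio_lt_of_lt_cof {α δ : Ordinal.{u}} (hδ : δ < α.cof.ord)
    (f : Set.Iio δ → Ordinal.{u}) (hf : ∀ i, f i < α) : ⨆ i, f i < α := by
  refine lift_iSup_lt_of_lt_cof ?_ hf
  rw [Cardinal.mk_Iio_ordinal, Cardinal.lift_lift, ← lift_cof, Cardinal.lift_lt]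
  exact lt_ord.1 hδ

/-- A cofinal map from the cofinality. -/
theorem exists_cofinal_map (α : Ordinal.{u}) :
    ∃ f : Ordinal.{u} → Ordinal.{u},
      (∀ i < α.cof.ord, f i < α) ∧ ∀ a < α, ∃ i < α.cof.ord, a ≤ f i := by
  obtain ⟨s, hs, hs'⟩ := Order.exists_cof_eq α.ToType
  rw [cof_toType] at hs'
  have he : Nonempty (Set.Iio α.cof.ord ≃ s) := by
    rw [← Cardinal.lift_mk_eq', Cardinal.mk_Iio_ordinal, card_ord, hs', Cardinal.lift_lift]
  obtain ⟨e⟩ := he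
  refine ⟨fun i => if h : i < α.cof.ord then (ToType.mk.symm (e ⟨i, h⟩ : α.ToType) : Ordinal)
    else 0, fun i hi => ?_, fun a ha => ?_⟩
  · simp only [dif_pos hi]
    exact (ToType.mk.symm (e ⟨i, hi⟩ : α.ToType)).2
  · obtain ⟨b, hb, hab⟩ := hs (ToType.mk ⟨a, ha⟩)
    refine ⟨e.symm ⟨b, hb⟩, (e.symm ⟨b, hb⟩).2, ?_⟩
    have h : (e.symm ⟨b, hb⟩ : Ordinal) < α.cof.ord := (e.symm ⟨b, hb⟩).2
    simp only [dif_pos h]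
    change a ≤ (ToType.mk.symm (e (e.symm ⟨b, hb⟩) : α.ToType) : Ordinal)
    rw [e.apply_symm_apply]
    exact (OrderIso.le_symm_apply ToType.mk).2 hab

theorem mk_iUnion_Iio_le {X : Type u} {μ : Cardinal.{u}} (hμ : ℵ₀ ≤ μ) {α : Ordinal.{u}}
    (hα : α < (Order.succ μ).ord) (S : Ordinal.{u} → Set X) (hS : ∀ i < α, #(S i) ≤ μ) :
    #(⋃ i : Set.Iio α, S i : Set X) ≤ μ := by
  rw [← Cardinal.lift_le.{u + 1}]
  refine (mk_iUnion_le_lift _).trans ?_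
  rw [Cardinal.mk_Iio_ordinal, Cardinal.lift_lift]
  have h1 : Cardinal.lift.{u + 1} α.card ≤ Cardinal.lift.{u + 1} μ := by
    rw [Cardinal.lift_le, ← Order.lt_succ_iff]
    exact lt_ord.1 hα
  have h2 : ⨆ i : Set.Iio α, Cardinal.lift.{u + 1} #(S i) ≤ Cardinal.lift.{u + 1} μ :=
    ciSup_le' fun i => Cardinal.lift_le.2 (hS i i.2)
  refine (mul_le_mul' (by simpa using h1) h2).trans ?_
  rw [mul_eq_self]
  simpa using hμ

theorem Submodule.mem_iSup_Iio {R M : Type*} [Ring R] [AddCommGroup M] [Module R M]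
    {x : Ordinal.{u} → Submodule R M} {δ : Ordinal.{u}} (hδ : 0 < δ)
    (hx : ∀ i j, i ≤ j → j < δ → x i ≤ x j) {m : M} :
    m ∈ ⨆ j : Set.Iio δ, x j ↔ ∃ j < δ, m ∈ x j := by
  have : Nonempty (Set.Iio δ) := ⟨⟨0, hδ⟩⟩
  rw [Submodule.mem_iSup_of_directed]
  · simp
  · intro i j
    rcases le_total i j with h | h
    · exact ⟨j, hx i j h j.2, le_rfl⟩
    · exact ⟨i, le_rfl, hx j i h i.2⟩

/-! ### Amalgamation and limit chains. -/

section Extension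

variable {R : Type u} [Ring R]

/-- Amalgamation over a universal extension: given `g : A → B` and an embedding `j : A → N'`,
the map `ι ∘ g` extends along `j`, and the extension identifies no more than it has to. -/
theorem IsUniversalOver.exists_extension {B C : Type u} [AddCommGroup B] [Module R B]
    [AddCommGroup C] [Module R C] {ι : B →ₗ[R] C} (hι : IsUniversalOver ι) (hB : ℵ₀ ≤ #B)
    {A N' : Type u} [AddCommGroup A] [Module R A] [AddCommGroup N'] [Module R N']
    (j : A →ₗ[R] N') (g : A →ₗ[R] B) (hj : Function.Injective j) (hN' : #N' ≤ #B) :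
    ∃ f : N' →ₗ[R] C, f ∘ₗ j = ι ∘ₗ g ∧ (∀ x b, f x = ι b → ∃ a, j a = x ∧ g a = b) := by
  -- The quotient by `K` is the pushout of `g` and `j`. Injectivity of `j` alone makes `B` embed in
  -- it; `g` may have a kernel, as maps from ideals do.
  let K : Submodule R (B × N') := LinearMap.range (g.prod (-j))
  have hK : ∀ b x, (b, x) ∈ K ↔ ∃ a, g a = b ∧ -j a = x := by
    intro b x
    simp [K, LinearMap.mem_range, Prod.ext_iff]
  let inB : B →ₗ[R] (B × N') ⧸ K := K.mkQ ∘ₗ LinearMap.inl R B N'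
  let inN : N' →ₗ[R] (B × N') ⧸ K := K.mkQ ∘ₗ LinearMap.inr R B N'
  have hinB : Function.Injective inB := by
    rw [← LinearMap.ker_eq_bot, LinearMap.ker_eq_bot']
    intro b hb
    have : (b, (0 : N')) ∈ K := by
      simpa [inB, Submodule.Quotient.mk_eq_zero] using hb
    obtain ⟨a, rfl, ha⟩ := (hK _ _).1 this
    have : a = 0 := hj (by simpa using ha)
    simp [this]
  have hcomm : ∀ a, inN (j a) = inB (g a) := by
    intro a
    refine (Submodule.Quotient.eq K).2 ?_
    exact (hK _ _).2 ⟨-a, by simp, by simp⟩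
  have hcard : #((B × N') ⧸ K) = #C := by
    rw [hι.2.1]
    apply le_antisymm
    · calc #((B × N') ⧸ K) ≤ #(B × N') := mk_le_of_surjective K.mkQ_surjective
        _ = #B * #N' := by simp
        _ ≤ #B * #B := mul_le_mul_right hN' _
        _ = #B := mul_eq_self hB
    · exact mk_le_of_injective hinB
  obtain ⟨F, hF, hFB⟩ := hι.2.2 _ inB hinB hcard
  refine ⟨F ∘ₗ inN, ?_, ?_⟩
  · ext a
    simp only [LinearMap.comp_apply, hcomm]
    exact LinearMap.congr_fun hFB (g a)
  · intro x b hxb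
    rw [← hFB] at hxb
    have h := (Submodule.Quotient.eq K).1 (hF hxb)
    obtain ⟨a, h1, h2⟩ := (hK _ _).1 h
    refine ⟨-a, ?_, ?_⟩
    · simpa using h2
    · simp only [map_neg, h1]; simp

variable {M : Type u} [AddCommGroup M] [Module R M]

/-- `B ≤ C` are submodules such that all maps from small modules into `B` extend to small
overmodules with values in `C`, in a way that identifies no more than necessary. -/
def IsExtensibleIn (μ : Cardinal.{u}) (B C : Submodule R M) : Prop :=
  B ≤ C ∧ ∀ (A N' : Type u) [AddCommGroup A] [Module R A] [AddCommGroup N'] [Module R N']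
    (j : A →ₗ[R] N') (g : A →ₗ[R] M), Function.Injective j → #N' ≤ μ → (∀ a, g a ∈ B) →
    ∃ f : N' →ₗ[R] M, (∀ x, f x ∈ C) ∧ (∀ a, f (j a) = g a) ∧
      (∀ x, f x ∈ B → x ∈ LinearMap.range j) ∧ (Function.Injective g → Function.Injective f)

/-- Together with its converse below, this replaces universality by a property of maps into the
fixed module `M`, which also controls which elements are sent into `B`. -/
theorem IsExtensibleIn.of_isUniversalOver {μ : Cardinal.{u}} (hμ : ℵ₀ ≤ μ) {B C : Submodule R M}
    (hB : #B = μ) (h : B ≤ C) (hu : IsUniversalOver (Submodule.inclusion h)) :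
    IsExtensibleIn μ B C := by
  refine ⟨h, ?_⟩
  intro A N' _ _ _ _ j g hj hN' hg
  obtain ⟨f, hf, hf'⟩ := hu.exists_extension (hμ.trans hB.ge) j (g.codRestrict B hg) hj
    (hN'.trans hB.ge)
  refine ⟨C.subtype ∘ₗ f, fun x => (f x).2, fun a => ?_, fun x hx => ?_, fun hgi => ?_⟩
  · exact congrArg Subtype.val (LinearMap.congr_fun hf a)
  · obtain ⟨a, ha, -⟩ := hf' x ⟨f x, hx⟩ rfl
    exact ⟨a, ha⟩
  · rw [← LinearMap.ker_eq_bot, LinearMap.ker_eq_bot']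
    intro x hx
    obtain ⟨a, rfl, ha⟩ := hf' x 0 (Subtype.ext (by simpa using hx))
    have : g a = 0 := congrArg Subtype.val ha
    rw [hgi (this.trans (map_zero g).symm), map_zero]

theorem IsExtensibleIn.isUniversalOver {μ : Cardinal.{u}} {B C : Submodule R M}
    (hB : #B = μ) (hC : #C = μ) (hu : IsExtensibleIn μ B C) :
    IsUniversalOver (Submodule.inclusion hu.1) := by
  refine ⟨Submodule.inclusion_injective _, hC.trans hB.symm, ?_⟩
  intro N' _ _ j hj hN'
  obtain ⟨f, hfC, hf, -, hfi⟩ := hu.2 B N' j B.subtype hj (hN'.trans hC).le fun b => b.2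
  refine ⟨f.codRestrict C hfC, fun x y hxy => ?_, ?_⟩
  · exact hfi B.subtype_injective (congrArg Subtype.val hxy)
  · ext b
    exact hf b

theorem IsExtensibleIn.mono {μ : Cardinal.{u}} {B B' C C' : Submodule R M}
    (h : IsExtensibleIn μ B' C) (hB : B = B') (hC : C ≤ C') : IsExtensibleIn μ B C' := by
  subst hB
  refine ⟨h.1.trans hC, ?_⟩
  intro A N' _ _ _ _ j g hj hN' hg
  obtain ⟨f, hfC, hf⟩ := h.2 A N' j g hj hN' hg
  exact ⟨f, fun x => hC (hfC x), hf⟩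

/-- A chain of submodules witnessing that a module is a limit model. -/
structure IsLimitChain (μ : Cardinal.{u}) (α : Ordinal.{u}) (F : Ordinal.{u} → Submodule R M) :
    Prop where
  card : ∀ i < α, #(F i) = μ
  mono : ∀ i j, i ≤ j → j < α → F i ≤ F j
  limit : ∀ i < α, Order.IsSuccLimit i → ∀ x ∈ F i, ∃ j < i, x ∈ F j
  cover : ∀ x, ∃ i < α, x ∈ F i
  ext : ∀ i < α, IsExtensibleIn μ (F i) (F (Order.succ i))

theorem isLimitModel_iff {μ : Cardinal.{u}} {α : Ordinal.{u}} :
    IsLimitModel R μ α M ↔ (ℵ₀ ≤ μ ∧ Order.IsSuccLimit α ∧ α < (Order.succ μ).ord) ∧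
      ∃ F : Ordinal.{u} → Submodule R M, IsLimitChain μ α F := by
  constructor
  · rintro ⟨N, hμ, hα, hα', F, h1, h2, h3, -, h5, h6⟩
    refine ⟨⟨hμ, hα, hα'⟩, F, h1, h2, ?_, ?_, ?_⟩
    · intro i hi hl x hx
      have : x ∈ (F i : Set M) := hx
      rw [h3 i hi hl] at this
      simpa using this
    · intro x
      have : x ∈ (Set.univ : Set M) := trivial
      rw [h5] at this
      simpa using this
    · intro i hi
      obtain ⟨h, hu⟩ := h6 i hi
      exact .of_isUniversalOver hμ (h1 i hi) h hu
  · rintro ⟨⟨hμ, hα, hα'⟩, F, h⟩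
    refine ⟨F 0, hμ, hα, hα', F, h.card, h.mono, ?_, rfl, ?_, ?_⟩
    · intro i hi hl
      ext x
      simp only [Set.mem_iUnion, SetLike.mem_coe, Set.mem_Iio, exists_prop]
      exact ⟨h.limit i hi hl x, fun ⟨j, hj, hx⟩ => h.mono j i hj.le hi hx⟩
    · ext x
      simpa using h.cover x
    · intro i hi
      exact ⟨(h.ext i hi).1, (h.ext i hi).isUniversalOver (h.card i hi)
        (h.card _ (hα.succ_lt hi))⟩

theorem IsLimitChain.card_eq {μ : Cardinal.{u}} {α : Ordinal.{u}}
    {F : Ordinal.{u} → Submodule R M} (h : IsLimitChain μ α F) (hμ : ℵ₀ ≤ μ)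
    (hα : Order.IsSuccLimit α) (hα' : α < (Order.succ μ).ord) : #M = μ := by
  apply le_antisymm
  · have hU : (Set.univ : Set M) = ⋃ i : Set.Iio α, (F i : Set M) := by
      ext x
      simpa using h.cover x
    rw [← mk_univ, hU]
    exact mk_iUnion_Iio_le hμ hα' (fun i => (F i : Set M)) fun i hi => (h.card i hi).le
  · rw [← h.card 0 hα.bot_lt]
    exact mk_le_of_injective (F 0).subtype_injective

end Extension

/-! ### Dependence on the cofinality only, and back-and-forth. -/

section Uniqueness

variable {R : Type u} [Ring R] {M : Type u} [AddCommGroup M] [Module R M]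
  {N : Type u} [AddCommGroup N] [Module R N]

/-- Stages `F a` are chosen with indices passing a cofinal sequence. Below `cof α` suprema of
indices stay below `α`, and universality survives enlarging `F (a + 1)` to a later stage. -/
theorem IsLimitChain.exists_reindex_cof {μ : Cardinal.{u}} {α : Ordinal.{u}}
    {F : Ordinal.{u} → Submodule R M} (h : IsLimitChain μ α F) (hα : Order.IsSuccLimit α) :
    ∃ G : Ordinal.{u} → Submodule R M, IsLimitChain μ α.cof.ord G := by
  obtain ⟨f, hf, hf'⟩ := exists_cofinal_map α
  have hκ : Order.IsSuccLimit α.cof.ord := isSuccLimit_ord (aleph0_le_cof_iff.2 (one_lt_cof_iff.2 hα))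
  obtain ⟨x, hmono, -, hP, hQ, hlim⟩ := exists_continuous_chain
    (fun _ x => ∃ a < α, x = F a)
    (fun i x y => ∃ a b, a < b ∧ b < α ∧ f i ≤ b ∧ x = F a ∧ y = F b) α.cof.ord (F 0)
    ⟨0, hα.bot_lt, rfl⟩
    (by
      rintro i hi _ ⟨a, ha, rfl⟩
      have hi' : f i < α := hf i ((Order.le_succ i).trans_lt hi)
      have hb : max (Order.succ a) (f i) < α := max_lt (hα.succ_lt ha) hi'
      have hab : a < max (Order.succ a) (f i) := (Order.lt_succ a).trans_le (le_max_left _ _)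
      exact ⟨_, h.mono _ _ hab.le hb, ⟨_, hb, rfl⟩, a, _, hab, hb, le_max_right _ _, rfl, rfl⟩)
    (by
      intro δ hδ hδl x hx hxP
      choose a ha hxa using fun j : Set.Iio δ => hxP j j.2
      have hs : ⨆ j, a j < α := iSup_Iio_lt_of_lt_cof hδ a ha
      refine ⟨_, hs, le_antisymm (iSup_le fun j => ?_) fun m hm => ?_⟩
      · rw [hxa]
        exact h.mono _ _ (Ordinal.le_iSup a j) hs
      · have key : ∃ j, m ∈ F (a j) := by
          -- The chosen indices need not be monotone. Either their supremum is attained, or it is a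
          -- limit ordinal and continuity of `F` applies.
          by_cases hex : ∃ j, a j = ⨆ j, a j
          · obtain ⟨j, hj⟩ := hex
            exact ⟨j, hj ▸ hm⟩
          · push Not at hex
            have hlt : ∀ j, a j < ⨆ j, a j := fun j => (Ordinal.le_iSup a j).lt_of_ne (hex j)
            have hsl : Order.IsSuccLimit (⨆ j, a j) := by
              refine ⟨fun hmin => ?_, fun t ht => ?_⟩
              · exact not_isMin_of_lt (hlt ⟨0, hδl.bot_lt⟩) hmin
              · obtain ⟨j, hj⟩ := (Ordinal.lt_iSup_iff).1 ht.lt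
                exact ht.2 hj (hlt j)
            obtain ⟨t, ht, hmt⟩ := h.limit _ hs hsl m hm
            obtain ⟨j, hj⟩ := (Ordinal.lt_iSup_iff).1 ht
            exact ⟨j, h.mono _ _ hj.le (ha j) hmt⟩
        obtain ⟨j, hj⟩ := key
        rw [← hxa] at hj
        exact le_iSup (fun j : Set.Iio δ => x j) j hj)
  refine ⟨x, ?_, fun i j hij _ => hmono hij, ?_, ?_, ?_⟩
  · intro i hi
    obtain ⟨a, ha, hxa⟩ := hP i hi
    rw [hxa]
    exact h.card a ha
  · intro i hi hil m hm
    rw [hlim i hil] at hm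
    exact (Submodule.mem_iSup_Iio hil.bot_lt fun _ _ hij _ => hmono hij).1 hm
  · intro m
    obtain ⟨a, ha, hm⟩ := h.cover m
    obtain ⟨i, hi, hai⟩ := hf' a ha
    obtain ⟨_, b, -, hb, hib, -, hxb⟩ := hQ i (hκ.succ_lt hi)
    refine ⟨_, hκ.succ_lt hi, ?_⟩
    rw [hxb]
    exact h.mono _ _ (hai.trans hib) hb hm
  · intro i hi
    obtain ⟨a, b, hab, hb, -, hxa, hxb⟩ := hQ i (hκ.succ_lt hi)
    rw [hxb]
    exact (h.ext a (hab.trans hb)).mono hxa (h.mono _ _ (Order.succ_le_of_lt hab) hb)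

/-- A limit model of length `α` is also one of length `cof α`. -/
theorem IsLimitModel.cof_ord {μ : Cardinal.{u}} {α : Ordinal.{u}} (h : IsLimitModel R μ α M) :
    IsLimitModel R μ α.cof.ord M := by
  obtain ⟨⟨hμ, hα, hα'⟩, F, hF⟩ := isLimitModel_iff.1 h
  exact isLimitModel_iff.2 ⟨⟨hμ, isSuccLimit_ord (aleph0_le_cof_iff.2 (one_lt_cof_iff.2 hα)),
    (ord_cof_le α).trans_lt hα'⟩, hF.exists_reindex_cof hα⟩

/-- The graph of an isomorphism between a submodule of `M` and a submodule of `N`. -/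
def IsPartialIso (p : Submodule R (M × N)) : Prop :=
  ∀ x ∈ p, x.1 = 0 ↔ x.2 = 0

theorem IsPartialIso.swap {p : Submodule R (M × N)} (hp : IsPartialIso p) :
    IsPartialIso (p.comap (LinearEquiv.prodComm R N M).toLinearMap) :=
  fun x hx => (hp x.swap hx).symm

/-- The graph `p` is itself the small module to be amalgamated: its second projection is extended
along its first, both being injective. -/
theorem IsPartialIso.exists_extend_domain {μ : Cardinal.{u}} {p : Submodule R (M × N)}
    (hp : IsPartialIso p) {B C : Submodule R N} (hBC : IsExtensibleIn μ B C) {D : Submodule R M}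
    (hD : #D ≤ μ) (hpD : ∀ x ∈ p, x.1 ∈ D) (hpB : ∀ x ∈ p, x.2 ∈ B) :
    ∃ q, p ≤ q ∧ IsPartialIso q ∧ (∀ x ∈ q, x.1 ∈ D) ∧ (∀ m ∈ D, ∃ n, (m, n) ∈ q) ∧
      ∀ x ∈ q, x.2 ∈ C := by
  obtain ⟨f, hfC, hf, -, hfi⟩ := hBC.2 p D
    ((LinearMap.fst R M N ∘ₗ p.subtype).codRestrict D fun x => hpD x x.2)
    (LinearMap.snd R M N ∘ₗ p.subtype)
    (by
      rw [← LinearMap.ker_eq_bot, LinearMap.ker_eq_bot']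
      intro x hx
      have h1 : (x : M × N).1 = 0 := congrArg Subtype.val hx
      exact Subtype.ext (Prod.ext h1 ((hp x x.2).1 h1)))
    hD (fun x => hpB x x.2)
  have hinj : Function.Injective f := by
    apply hfi
    rw [← LinearMap.ker_eq_bot, LinearMap.ker_eq_bot']
    intro x hx
    have h1 : (x : M × N).2 = 0 := hx
    exact Subtype.ext (Prod.ext ((hp x x.2).2 h1) h1)
  refine ⟨LinearMap.range (D.subtype.prod f), ?_, ?_, ?_, ?_, ?_⟩
  · intro x hx
    refine ⟨⟨x.1, hpD x hx⟩, Prod.ext rfl ?_⟩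
    exact hf ⟨x, hx⟩
  · rintro _ ⟨m, rfl⟩
    change (m : M) = 0 ↔ f m = 0
    rw [map_eq_zero_iff f hinj, Submodule.coe_eq_zero]
  · rintro _ ⟨m, rfl⟩
    exact m.2
  · intro m hm
    exact ⟨f ⟨m, hm⟩, ⟨m, hm⟩, rfl⟩
  · rintro _ ⟨m, rfl⟩
    exact hfC m

/-- The forth step takes all of `F a` into `G (a + 1)` and keeps first coordinates in `F a`. The
back step can therefore use `F (a + 1)` over `F a`, with all of `G (a + 1)` as domain. -/
theorem IsLimitChain.exists_extend_partialIso {μ : Cardinal.{u}} {α : Ordinal.{u}}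
    {F : Ordinal.{u} → Submodule R M} {G : Ordinal.{u} → Submodule R N}
    (hF : IsLimitChain μ α F) (hG : IsLimitChain μ α G) (hα : Order.IsSuccLimit α)
    {a : Ordinal.{u}} (ha : a < α) {p : Submodule R (M × N)} (hp : IsPartialIso p)
    (hpF : ∀ x ∈ p, x.1 ∈ F a) (hpG : ∀ x ∈ p, x.2 ∈ G a) :
    ∃ q, p ≤ q ∧ IsPartialIso q ∧
      ((∀ x ∈ q, x.1 ∈ F (Order.succ a)) ∧ ∀ x ∈ q, x.2 ∈ G (Order.succ a)) ∧
      (∀ m ∈ F a, ∃ n, (m, n) ∈ q) ∧ ∀ n ∈ G a, ∃ m, (m, n) ∈ q := by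
  obtain ⟨q, hpq, hq, hq1, hq2, hq3⟩ := hp.exists_extend_domain (hG.ext a ha)
    (hF.card a ha).le hpF hpG
  obtain ⟨r, hqr, hr, hr1, hr2, hr3⟩ := hq.swap.exists_extend_domain (hF.ext a ha)
    (hG.card _ (hα.succ_lt ha)).le (fun x hx => hq3 x.swap hx) (fun x hx => hq1 x.swap hx)
  have hqr' : ∀ x ∈ q, x.swap ∈ r := fun x hx => hqr (by simpa using hx)
  refine ⟨r.comap (LinearEquiv.prodComm R M N).toLinearMap, fun x hx => hqr' x (hpq hx), hr.swap,
    ⟨fun x hx => hr3 x.swap hx, fun x hx => hr1 x.swap hx⟩, fun m hm => ?_, fun n hn => ?_⟩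
  · obtain ⟨n, hn⟩ := hq2 m hm
    exact ⟨n, hqr' _ hn⟩
  · exact hr2 n ((hG.ext a ha).1 hn)

theorem IsPartialIso.nonempty_linearEquiv {p : Submodule R (M × N)} (hp : IsPartialIso p)
    (h1 : ∀ m, ∃ n, (m, n) ∈ p) (h2 : ∀ n, ∃ m, (m, n) ∈ p) : Nonempty (M ≃ₗ[R] N) := by
  have e1 : Function.Bijective (LinearMap.fst R M N ∘ₗ p.subtype) := by
    refine ⟨?_, fun m => ?_⟩
    · rw [← LinearMap.ker_eq_bot, LinearMap.ker_eq_bot']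
      intro x hx
      have hx : (x : M × N).1 = 0 := hx
      exact Subtype.ext (Prod.ext hx ((hp x x.2).1 hx))
    · obtain ⟨n, hn⟩ := h1 m
      exact ⟨⟨_, hn⟩, rfl⟩
  have e2 : Function.Bijective (LinearMap.snd R M N ∘ₗ p.subtype) := by
    refine ⟨?_, fun n => ?_⟩
    · rw [← LinearMap.ker_eq_bot, LinearMap.ker_eq_bot']
      intro x hx
      have hx : (x : M × N).2 = 0 := hx
      exact Subtype.ext (Prod.ext ((hp x x.2).2 hx) hx)
    · obtain ⟨m, hm⟩ := h2 n
      exact ⟨⟨_, hm⟩, rfl⟩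
  exact ⟨(LinearEquiv.ofBijective _ e1).symm.trans (LinearEquiv.ofBijective _ e2)⟩

/-- Limit models of the same length are isomorphic. -/
theorem IsLimitModel.nonempty_linearEquiv {μ : Cardinal.{u}} {α : Ordinal.{u}}
    (hM : IsLimitModel R μ α M) (hN : IsLimitModel R μ α N) : Nonempty (M ≃ₗ[R] N) := by
  obtain ⟨⟨-, hα, -⟩, F, hF⟩ := isLimitModel_iff.1 hM
  obtain ⟨-, G, hG⟩ := isLimitModel_iff.1 hN
  -- Starting from the zero isomorphism, no relation between `F 0` and `G 0` is needed.
  obtain ⟨p₀, -, hp₀⟩ := hF.exists_extend_partialIso hG hα hα.bot_lt (p := ⊥)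
    (fun x hx => by rw [(Submodule.mem_bot R).1 hx]; simp)
    (fun x hx => by rw [(Submodule.mem_bot R).1 hx]; exact zero_mem _)
    (fun x hx => by rw [(Submodule.mem_bot R).1 hx]; exact zero_mem _)
  obtain ⟨x, hmono, -, hP, -, -⟩ := exists_continuous_chain
    (fun i q => IsPartialIso q ∧
      ((∀ x ∈ q, x.1 ∈ F (Order.succ i)) ∧ ∀ x ∈ q, x.2 ∈ G (Order.succ i)) ∧
      (∀ m ∈ F i, ∃ n, (m, n) ∈ q) ∧ ∀ n ∈ G i, ∃ m, (m, n) ∈ q)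
    (fun _ _ _ => True) α p₀ hp₀
    (by
      intro i hi q hq
      obtain ⟨r, hqr, hr, hr1, hr2, hr3⟩ :=
        hF.exists_extend_partialIso hG hα hi hq.1 hq.2.1.1 hq.2.1.2
      exact ⟨r, hqr, ⟨hr, hr1, hr2, hr3⟩, trivial⟩)
    (by
      intro δ hδ hδl x hx hxP
      have hmem : ∀ y, y ∈ ⨆ j : Set.Iio δ, x j ↔ ∃ j < δ, y ∈ x j := fun y =>
        Submodule.mem_iSup_Iio hδl.bot_lt fun _ _ hij _ => hx hij
      refine ⟨fun y hy => ?_, ⟨fun y hy => ?_, fun y hy => ?_⟩, fun m hm => ?_, fun n hn => ?_⟩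
      · obtain ⟨j, hj, hy⟩ := (hmem y).1 hy
        exact (hxP j hj).1 y hy
      · obtain ⟨j, hj, hy⟩ := (hmem y).1 hy
        exact hF.mono _ _ (Order.succ_le_succ hj.le) (hα.succ_lt hδ) ((hxP j hj).2.1.1 y hy)
      · obtain ⟨j, hj, hy⟩ := (hmem y).1 hy
        exact hG.mono _ _ (Order.succ_le_succ hj.le) (hα.succ_lt hδ) ((hxP j hj).2.1.2 y hy)
      · obtain ⟨j, hj, hm⟩ := hF.limit δ hδ hδl m hm
        obtain ⟨n, hn⟩ := (hxP j hj).2.2.1 m hm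
        exact ⟨n, (hmem _).2 ⟨j, hj, hn⟩⟩
      · obtain ⟨j, hj, hn⟩ := hG.limit δ hδ hδl n hn
        obtain ⟨m, hm⟩ := (hxP j hj).2.2.2 n hn
        exact ⟨m, (hmem _).2 ⟨j, hj, hm⟩⟩)
  have hmem : ∀ y, y ∈ ⨆ j : Set.Iio α, x j ↔ ∃ j < α, y ∈ x j := fun y =>
    Submodule.mem_iSup_Iio hα.bot_lt fun _ _ hij _ => hmono hij
  refine IsPartialIso.nonempty_linearEquiv (p := ⨆ j : Set.Iio α, x j) (fun y hy => ?_)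
    (fun m => ?_) fun n => ?_
  · obtain ⟨j, hj, hy⟩ := (hmem y).1 hy
    exact (hP j hj).1 y hy
  · obtain ⟨j, hj, hm⟩ := hF.cover m
    obtain ⟨n, hn⟩ := (hP j hj).2.2.1 m hm
    exact ⟨n, (hmem _).2 ⟨j, hj, hn⟩⟩
  · obtain ⟨j, hj, hn⟩ := hG.cover n
    obtain ⟨m, hm⟩ := (hP j hj).2.2.2 n hn
    exact ⟨m, (hmem _).2 ⟨j, hj, hm⟩⟩

end Uniqueness

/-! ### Limit models of large cofinality are injective and isomorphic. -/

section Injectivity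

variable {R : Type u} [Ring R] {M : Type u} [AddCommGroup M] [Module R M]
  {N : Type u} [AddCommGroup N] [Module R N]

/-- The square of a limit model is a limit model of the same length. -/
theorem IsLimitModel.prod_self {μ : Cardinal.{u}} {α : Ordinal.{u}} (h : IsLimitModel R μ α M) :
    IsLimitModel R μ α (M × M) := by
  obtain ⟨⟨hμ, hα, hα'⟩, F, hF⟩ := isLimitModel_iff.1 h
  have hcard : ∀ i < α, #((F i).prod (F i)) = μ := by
    intro i hi
    have := mk_congr (Equiv.Set.prod (F i : Set M) (F i : Set M))
    rw [← mul_def] at this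
    refine this.trans ?_
    rw [show #(F i : Set M) = μ from hF.card i hi, mul_eq_self hμ]
  refine isLimitModel_iff.2 ⟨⟨hμ, hα, hα'⟩, fun i => (F i).prod (F i), hcard, ?_, ?_, ?_, ?_⟩
  · intro i j hij hj
    exact Submodule.prod_mono (hF.mono i j hij hj) (hF.mono i j hij hj)
  · rintro i hi hil x ⟨hx1, hx2⟩
    obtain ⟨j, hj, hx1⟩ := hF.limit i hi hil _ hx1
    obtain ⟨k, hk, hx2⟩ := hF.limit i hi hil _ hx2
    exact ⟨max j k, max_lt hj hk, hF.mono _ _ (le_max_left _ _) ((max_lt hj hk).trans hi) hx1,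
      hF.mono _ _ (le_max_right _ _) ((max_lt hj hk).trans hi) hx2⟩
  · intro x
    obtain ⟨j, hj, hx1⟩ := hF.cover x.1
    obtain ⟨k, hk, hx2⟩ := hF.cover x.2
    exact ⟨max j k, max_lt hj hk, hF.mono _ _ (le_max_left _ _) (max_lt hj hk) hx1,
      hF.mono _ _ (le_max_right _ _) (max_lt hj hk) hx2⟩
  · intro i hi
    have hle := (hF.ext i hi).1
    refine .of_isUniversalOver hμ (hcard i hi) (Submodule.prod_mono hle hle)
      ⟨Submodule.inclusion_injective _, (hcard _ (hα.succ_lt hi)).trans (hcard i hi).symm, ?_⟩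
    intro N' _ _ j hj hN'
    let ι₁ : F i →ₗ[R] (F i).prod (F i) :=
      (LinearMap.inl R M M ∘ₗ (F i).subtype).codRestrict _ fun x => ⟨x.2, zero_mem _⟩
    let ι₂ : F i →ₗ[R] (F i).prod (F i) :=
      (LinearMap.inr R M M ∘ₗ (F i).subtype).codRestrict _ fun x => ⟨zero_mem _, x.2⟩
    have hι : ∀ x : (F i).prod (F i), x = ι₁ ⟨x.1.1, x.2.1⟩ + ι₂ ⟨x.1.2, x.2.2⟩ := by
      intro x
      exact Subtype.ext (Prod.ext (add_zero _).symm (zero_add _).symm)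
    have hdisj : ∀ b c, j (ι₁ b) = j (ι₂ c) → b = 0 ∧ c = 0 := by
      intro b c hbc
      have := congrArg Subtype.val (hj hbc)
      have h1 : (b : M) = 0 := congrArg Prod.fst this
      have h2 : 0 = (c : M) := congrArg Prod.snd this
      exact ⟨Subtype.ext h1, Subtype.ext h2.symm⟩
    -- Dividing `N'` by one copy of `F i` and embedding the quotient over the other gives a
    -- coordinate map whose kernel is exactly the first copy. The two copies meet in zero, so the
    -- two coordinate maps are jointly injective.
    have key : ∀ ι ι' : F i →ₗ[R] (F i).prod (F i),
        (∀ b c, j (ι b) = j (ι' c) → b = 0 ∧ c = 0) →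
        ∃ f : N' →ₗ[R] M, (∀ x, f x ∈ F (Order.succ i)) ∧ (∀ b, f (j (ι b)) = b) ∧
          (∀ b, f (j (ι' b)) = 0) ∧ ∀ x, f x = 0 → ∃ c, j (ι' c) = x := by
      intro ι ι' hd
      let K := LinearMap.range (j ∘ₗ ι')
      obtain ⟨f, hfC, hf, -, hfi⟩ := (hF.ext i hi).2 (F i) (N' ⧸ K) (K.mkQ ∘ₗ j ∘ₗ ι)
        (F i).subtype
        (by
          rw [← LinearMap.ker_eq_bot, LinearMap.ker_eq_bot']
          intro b hb
          obtain ⟨c, hc⟩ := (Submodule.Quotient.mk_eq_zero K).1 hb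
          exact (hd b c hc.symm).1)
        ((mk_le_of_surjective K.mkQ_surjective).trans
          (hN'.trans (hcard _ (hα.succ_lt hi))).le) (fun b => b.2)
      have hfi := hfi (F i).subtype_injective
      refine ⟨f ∘ₗ K.mkQ, fun x => hfC _, hf, fun b => ?_, fun x hx => ?_⟩
      · have : K.mkQ (j (ι' b)) = 0 := (Submodule.Quotient.mk_eq_zero K).2 ⟨b, rfl⟩
        rw [LinearMap.comp_apply, this, map_zero]
      · exact (Submodule.Quotient.mk_eq_zero K).1 ((map_eq_zero_iff f hfi).1 hx)
    obtain ⟨f₁, h1C, h1, h1', h1k⟩ := key ι₁ ι₂ hdisj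
    obtain ⟨f₂, h2C, h2, h2', h2k⟩ := key ι₂ ι₁ fun b c hbc => (hdisj c b hbc.symm).symm
    refine ⟨(f₁.prod f₂).codRestrict _ fun x => ⟨h1C x, h2C x⟩, ?_, ?_⟩
    · rw [← LinearMap.ker_eq_bot, LinearMap.ker_eq_bot']
      intro x hx
      have hx := congrArg Subtype.val hx
      obtain ⟨c, rfl⟩ := h1k x (congrArg Prod.fst hx)
      obtain ⟨b, hb⟩ := h2k _ (congrArg Prod.snd hx)
      rw [(hdisj b c hb).2, map_zero, map_zero]
    · ext x
      · change f₁ (j x) = x.1.1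
        conv_lhs => rw [hι x]
        simp [h1, h1']
      · change f₂ (j x) = x.1.2
        conv_lhs => rw [hι x]
        simp [h2, h2']

/-- Homomorphisms from a left ideal with few generators into a limit model extend to the ring. -/
theorem IsLimitModel.exists_extension_ideal {μ : Cardinal.{u}} {α : Ordinal.{u}}
    (h : IsLimitModel R μ α M) (hR : #R ≤ μ) {S : Set R} (hS : #S < α.cof)
    (f : Ideal.span S →ₗ[R] M) :
    ∃ g : R →ₗ[R] M, ∀ x : Ideal.span S, g x = f x := by
  obtain ⟨⟨hμ, hα, hα'⟩, F, hF⟩ := isLimitModel_iff.1 h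
  choose a ha hfa using fun s : S => hF.cover (f ⟨s, Ideal.subset_span s.2⟩)
  have hs : ⨆ s, a s < α := iSup_lt_of_lt_cof hS ha
  have hmem : ∀ x, f x ∈ F (⨆ s, a s) := by
    have : (⊤ : Submodule R (Ideal.span S)) ≤ (F (⨆ s, a s)).comap f := by
      rw [← Submodule.span_span_coe_preimage (R := R) (s := S), Submodule.span_le]
      rintro ⟨x, hx'⟩ hx
      exact hF.mono _ _ (Ordinal.le_iSup a ⟨x, hx⟩) hs (hfa ⟨x, hx⟩)
    exact fun x => this trivial
  obtain ⟨g, -, hg, -⟩ := (hF.ext _ hs).2 _ R (Ideal.span S).subtype f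
    (Submodule.subtype_injective _) hR hmem
  exact ⟨g, hg⟩

/-- Baer's criterion: every left ideal has fewer than `γ(R) ≤ cof α` generators. -/
theorem IsLimitModel.injective {μ : Cardinal.{u}} {α : Ordinal.{u}}
    (h : IsLimitModel R μ α M) (hR : #R ≤ μ) (hγ : gammaCard R ≤ α.cof) :
    Module.Injective R M := by
  apply Module.Baer.injective
  intro I g
  obtain ⟨S, hS, rfl⟩ := (gammaCard_spec R).2 I
  obtain ⟨g', hg'⟩ := h.exists_extension_ideal hR (hS.trans_le hγ) g
  exact ⟨g', fun x hx => hg' ⟨x, hx⟩⟩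

/-- Every module of cardinality at most `μ` embeds in every `μ`-limit model. -/
theorem IsLimitModel.exists_embedding {μ : Cardinal.{u}} {α : Ordinal.{u}}
    (h : IsLimitModel R μ α M) (hN : #N ≤ μ) : ∃ f : N →ₗ[R] M, Function.Injective f := by
  obtain ⟨⟨hμ, hα, hα'⟩, F, hF⟩ := isLimitModel_iff.1 h
  obtain ⟨f, -, -, -, hf⟩ := (hF.ext 0 hα.bot_lt).2 PUnit N 0 0
    (Function.injective_of_subsingleton _) hN (fun _ => zero_mem _)
  exact ⟨f, hf (Function.injective_of_subsingleton _)⟩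

/-- Injectivity gives a retraction of `f`, whose kernel is the complement. -/
theorem Module.Injective.exists_prod_equiv [Module.Injective R M] {f : M →ₗ[R] N}
    (hf : Function.Injective f) :
    ∃ (C : Type u) (_ : AddCommGroup C) (_ : Module R C), Nonempty (N ≃ₗ[R] M × C) := by
  obtain ⟨g, hg⟩ := Module.Injective.out f hf (LinearMap.id (R := R) (M := M))
  refine ⟨LinearMap.ker g, inferInstance, inferInstance, ⟨?_⟩⟩
  refine LinearEquiv.ofBijective
    (g.prod ((LinearMap.id - f ∘ₗ g).codRestrict (LinearMap.ker g) fun x => by simp [hg])) ⟨?_, ?_⟩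
  · rw [← LinearMap.ker_eq_bot, LinearMap.ker_eq_bot']
    intro x hx
    have h1 : g x = 0 := congrArg Prod.fst hx
    have h2 : x - f (g x) = 0 := congrArg Subtype.val (congrArg Prod.snd hx)
    simpa [h1] using h2
  · rintro ⟨m, c, hc⟩
    have hc : g c = 0 := hc
    refine ⟨f m + c, ?_⟩
    ext <;> simp [hg, hc]

/-- Pełczyński's decomposition argument for injective modules. -/
theorem nonempty_linearEquiv_of_injective [Module.Injective R M] [Module.Injective R N]
    (hM : Nonempty (M ≃ₗ[R] M × M)) (hN : Nonempty (N ≃ₗ[R] N × N))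
    {f : M →ₗ[R] N} (hf : Function.Injective f) {g : N →ₗ[R] M} (hg : Function.Injective g) :
    Nonempty (M ≃ₗ[R] N) := by
  obtain ⟨C, _, _, ⟨eC⟩⟩ := Module.Injective.exists_prod_equiv hf
  obtain ⟨D, _, _, ⟨eD⟩⟩ := Module.Injective.exists_prod_equiv hg
  obtain ⟨eM⟩ := hM
  obtain ⟨eN⟩ := hN
  -- `N ≅ M × C ≅ (M × M) × C ≅ M × N`, and symmetrically `M ≅ N × M`.
  have h1 : N ≃ₗ[R] M × N := eC.trans ((eM.prodCongr (.refl R C)).trans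
    ((LinearEquiv.prodAssoc R M M C).trans ((LinearEquiv.refl R M).prodCongr eC.symm)))
  have h2 : M ≃ₗ[R] N × M := eD.trans ((eN.prodCongr (.refl R D)).trans
    ((LinearEquiv.prodAssoc R N N D).trans ((LinearEquiv.refl R N).prodCongr eD.symm)))
  exact ⟨h2.trans ((LinearEquiv.prodComm R N M).trans h1.symm)⟩

/-- Limit models whose length has cofinality at least `γ(R)` are isomorphic. -/
theorem IsLimitModel.nonempty_linearEquiv_of_gammaCard_le {μ : Cardinal.{u}} {α β : Ordinal.{u}}
    (hM : IsLimitModel R μ α M) (hN : IsLimitModel R μ β N) (hR : #R ≤ μ)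
    (hα : gammaCard R ≤ α.cof) (hβ : gammaCard R ≤ β.cof) : Nonempty (M ≃ₗ[R] N) := by
  have := hM.injective hR hα
  have := hN.injective hR hβ
  have hMc : #M = μ := by
    obtain ⟨⟨hμ, hα, hα'⟩, F, hF⟩ := isLimitModel_iff.1 hM
    exact hF.card_eq hμ hα hα'
  have hNc : #N = μ := by
    obtain ⟨⟨hμ, hα, hα'⟩, F, hF⟩ := isLimitModel_iff.1 hN
    exact hF.card_eq hμ hα hα'
  obtain ⟨f, hf⟩ := hN.exists_embedding (N := M) hMc.le
  obtain ⟨g, hg⟩ := hM.exists_embedding (N := N) hNc.le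
  exact nonempty_linearEquiv_of_injective (hM.nonempty_linearEquiv hM.prod_self)
    (hN.nonempty_linearEquiv hN.prod_self) hf hg

end Injectivity

/-! ### Maps from ideals that do not extend, below `γ(R)`. -/

section Nonextension

variable {R : Type u} [Ring R] {M : Type u} [AddCommGroup M] [Module R M]

/-- If `κ < γ(R)`, there is a strictly increasing chain of left ideals of length `κ`, given by
successively adding a generator. -/
theorem exists_seq_notMem_span {κ : Cardinal.{u}} (hκ : ℵ₀ ≤ κ) (hκγ : κ < gammaCard R) :
    ∃ a : Ordinal.{u} → R, ∀ i < κ.ord, a i ∉ Ideal.span (a '' Set.Iio i) := by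
  have hI : ∃ I : Ideal R, ¬ IsLTGenerated κ I := by
    by_contra! h
    exact hκγ.not_ge (csInf_le' ⟨hκ, h⟩)
  obtain ⟨I, hI⟩ := hI
  -- The conditions on `T` sit under the existential so that the choice function is total and the
  -- recursion for `a` carries no proofs.
  have hc : ∀ T : Set R, ∃ r, T ⊆ I → #T < κ → r ∈ I ∧ r ∉ Ideal.span T := by
    intro T
    by_cases hT : T ⊆ I ∧ #T < κ
    · have hlt : Ideal.span T < I :=
        lt_of_le_of_ne (Ideal.span_le.2 hT.1) fun h => hI ⟨T, hT.2, h⟩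
      obtain ⟨r, hr, hr'⟩ := SetLike.exists_of_lt hlt
      exact ⟨r, fun _ _ => ⟨hr, hr'⟩⟩
    · exact ⟨0, fun h1 h2 => (hT ⟨h1, h2⟩).elim⟩
  choose c hc using hc
  let a : Ordinal.{u} → R := Ordinal.lt_wf.fix fun i ih => c (Set.range fun j : Set.Iio i => ih j j.2)
  have ha : ∀ i, a i = c (a '' Set.Iio i) := by
    intro i
    rw [Set.image_eq_range]
    exact Ordinal.lt_wf.fix_eq _ i
  have hcard : ∀ i < κ.ord, #(a '' Set.Iio i) < κ := by
    intro i hi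
    rw [← Cardinal.lift_lt.{u, u + 1}]
    have h := mk_image_le_lift (f := a) (s := Set.Iio i)
    rw [Cardinal.mk_Iio_ordinal] at h
    refine lt_of_le_of_lt (by simpa using h) ?_
    simpa [← Ordinal.lift_card] using lt_ord.1 hi
  have hmem : ∀ i < κ.ord, a i ∈ I := by
    intro i
    induction i using WellFoundedLT.induction with
    | ind i ih =>
      intro hi
      rw [ha]
      refine (hc _ ?_ (hcard i hi)).1
      rintro _ ⟨j, hj, rfl⟩
      exact ih j hj (lt_trans hj hi)
  refine ⟨a, fun i hi => ?_⟩
  rw [ha i]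
  refine (hc _ ?_ (hcard i hi)).2
  rintro _ ⟨j, hj, rfl⟩
  exact hmem j (lt_trans hj hi)

/-- In a limit model of length `κ < γ(R)` there is a homomorphism from a `κ`-generated left ideal
that does not extend to the ring. -/
theorem IsLimitModel.exists_not_extension {μ κ : Cardinal.{u}} (h : IsLimitModel R μ κ.ord M)
    (hR : #R ≤ μ) (hκ : ℵ₀ ≤ κ) (hκγ : κ < gammaCard R) :
    ∃ S : Set R, #S ≤ κ ∧ ∃ f : Ideal.span S →ₗ[R] M,
      ¬ ∃ g : R →ₗ[R] M, ∀ x : Ideal.span S, g x = f x := by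
  obtain ⟨⟨hμ, hα, hα'⟩, F, hF⟩ := isLimitModel_iff.1 h
  obtain ⟨a, ha⟩ := exists_seq_notMem_span hκ hκγ
  -- Graphs of maps on the ideals `I i` spanned by the earlier `a j` are built with `a i` sent
  -- outside `F i`. This is possible because the amalgam sends only elements of `I i` into `F i`,
  -- and `a i ∉ I i`.
  obtain ⟨x, hmono, -, hP, hQ, -⟩ := exists_continuous_chain
    (fun i (p : Submodule R (R × M)) => (∀ y ∈ p, y.1 = 0 → y.2 = 0) ∧ (∀ y ∈ p, y.2 ∈ F i) ∧
      ∀ r, r ∈ Ideal.span (a '' Set.Iio i) ↔ ∃ m, (r, m) ∈ p)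
    (fun i _ q => ∃ m ∉ F i, (a i, m) ∈ q) κ.ord ⊥
    (by
      refine ⟨fun y hy _ => ?_, fun y hy => ?_, fun r => ?_⟩
      · rw [(Submodule.mem_bot R).1 hy]; rfl
      · rw [(Submodule.mem_bot R).1 hy]; exact zero_mem _
      · simp)
    (by
      rintro i hi p ⟨hp, hpF, hpD⟩
      have hi' : i < κ.ord := (Order.le_succ i).trans_lt hi
      let D : Ideal R := Ideal.span (a '' Set.Iio (Order.succ i))
      have hpD' : ∀ y ∈ p, y.1 ∈ D := fun y hy =>
        Ideal.span_mono (Set.image_mono (Set.Iio_subset_Iio (Order.le_succ i)))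
          ((hpD _).2 ⟨_, hy⟩)
      obtain ⟨f, hfC, hf, hfB, -⟩ := (hF.ext i hi').2 p D
        ((LinearMap.fst R R M ∘ₗ p.subtype).codRestrict D fun y => hpD' y y.2)
        (LinearMap.snd R R M ∘ₗ p.subtype)
        (by
          rw [← LinearMap.ker_eq_bot, LinearMap.ker_eq_bot']
          intro y hy
          have h1 : (y : R × M).1 = 0 := congrArg Subtype.val hy
          exact Subtype.ext (Prod.ext h1 (hp y y.2 h1)))
        ((mk_le_of_injective D.subtype_injective).trans hR) (fun y => hpF y y.2)
      refine ⟨LinearMap.range (D.subtype.prod f), fun y hy => ⟨⟨y.1, hpD' y hy⟩,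
        Prod.ext rfl (hf ⟨y, hy⟩)⟩, ⟨?_, ?_, fun r => ⟨fun hr => ⟨_, ⟨r, hr⟩, rfl⟩, ?_⟩⟩, ?_⟩
      · rintro _ ⟨d, rfl⟩ hd
        have : d = 0 := Subtype.ext hd
        simp [this]
      · rintro _ ⟨d, rfl⟩
        exact hfC d
      · rintro ⟨m, d, hd⟩
        have : (d : R) = r := congrArg Prod.fst hd
        exact this ▸ d.2
      · have hai : a i ∈ D := Ideal.subset_span ⟨i, Order.lt_succ i, rfl⟩
        refine ⟨f ⟨a i, hai⟩, fun hm => ha i hi' ?_, ⟨a i, hai⟩, rfl⟩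
        obtain ⟨y, hy⟩ := hfB _ hm
        have : (y : R × M).1 = a i := congrArg Subtype.val hy
        rw [← this]
        exact (hpD _).2 ⟨_, y.2⟩)
    (by
      intro δ hδ hδl x hx hxP
      have hmem : ∀ y, y ∈ ⨆ j : Set.Iio δ, x j ↔ ∃ j < δ, y ∈ x j := fun y =>
        Submodule.mem_iSup_Iio hδl.bot_lt fun _ _ hij _ => hx hij
      refine ⟨fun y hy => ?_, fun y hy => ?_, fun r => ⟨fun hr => ?_, ?_⟩⟩
      · obtain ⟨j, hj, hy⟩ := (hmem y).1 hy
        exact (hxP j hj).1 y hy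
      · obtain ⟨j, hj, hy⟩ := (hmem y).1 hy
        exact hF.mono _ _ hj.le hδ ((hxP j hj).2.1 y hy)
      · have hle : Ideal.span (a '' Set.Iio δ) ≤
            (⨆ j : Set.Iio δ, x j).map (LinearMap.fst R R M) := by
          rw [Ideal.span_le]
          rintro _ ⟨k, hk, rfl⟩
          have hk' := hδl.succ_lt hk
          obtain ⟨m, hm⟩ := ((hxP _ hk').2.2 (a k)).1
            (Ideal.subset_span ⟨k, Order.lt_succ k, rfl⟩)
          exact ⟨_, (hmem _).2 ⟨_, hk', hm⟩, rfl⟩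
        obtain ⟨⟨r', m⟩, hm, rfl⟩ := hle hr
        exact ⟨m, hm⟩
      · rintro ⟨m, hm⟩
        obtain ⟨j, hj, hm⟩ := (hmem _).1 hm
        exact Ideal.span_mono (Set.image_mono (Set.Iio_subset_Iio hj.le))
          (((hxP j hj).2.2 r).2 ⟨m, hm⟩))
  let p : Submodule R (R × M) := ⨆ j : Set.Iio κ.ord, x j
  have hmem : ∀ y, y ∈ p ↔ ∃ j < κ.ord, y ∈ x j := fun y =>
    Submodule.mem_iSup_Iio hα.bot_lt fun _ _ hij _ => hmono hij
  let S : Set R := a '' Set.Iio κ.ord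
  have hpS : ∀ y ∈ p, y.1 ∈ Ideal.span S := by
    intro y hy
    obtain ⟨j, hj, hy⟩ := (hmem y).1 hy
    exact Ideal.span_mono (Set.image_mono (Set.Iio_subset_Iio hj.le))
      (((hP j hj).2.2 _).2 ⟨_, hy⟩)
  have hSp : Ideal.span S ≤ p.map (LinearMap.fst R R M) := by
    rw [Ideal.span_le]
    rintro _ ⟨k, hk, rfl⟩
    obtain ⟨m, -, hm⟩ := hQ k (hα.succ_lt hk)
    exact ⟨_, (hmem _).2 ⟨_, hα.succ_lt hk, hm⟩, rfl⟩
  have hbij : Function.Bijective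
      ((LinearMap.fst R R M ∘ₗ p.subtype).codRestrict (Ideal.span S) fun y => hpS y y.2) := by
    refine ⟨?_, fun ⟨r, hr⟩ => ?_⟩
    · rw [← LinearMap.ker_eq_bot, LinearMap.ker_eq_bot']
      rintro ⟨y, hy⟩ hy0
      have h1 : y.1 = 0 := congrArg Subtype.val hy0
      obtain ⟨j, hj, hyj⟩ := (hmem y).1 hy
      exact Subtype.ext (Prod.ext h1 ((hP j hj).1 y hyj h1))
    · obtain ⟨y, hy, rfl⟩ := hSp hr
      exact ⟨⟨y, hy⟩, rfl⟩
  let e := LinearEquiv.ofBijective _ hbij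
  refine ⟨S, ?_, LinearMap.snd R R M ∘ₗ p.subtype ∘ₗ e.symm.toLinearMap, ?_⟩
  · rw [← Cardinal.lift_le.{u + 1, u}]
    have h := mk_image_le_lift (f := a) (s := Set.Iio κ.ord)
    rw [Cardinal.mk_Iio_ordinal, card_ord] at h
    simpa using h
  · rintro ⟨g, hg⟩
    -- An extension `g` has `g 1` in some `F i`, which forces `g (a i) = a i • g 1` into `F i`,
    -- against the construction.
    obtain ⟨i, hi, hgi⟩ := hF.cover (g 1)
    obtain ⟨m, hmF, hm⟩ := hQ i (hα.succ_lt hi)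
    have hmp : (a i, m) ∈ p := (hmem _).2 ⟨_, hα.succ_lt hi, hm⟩
    have h1 := hg (e ⟨_, hmp⟩)
    simp only [LinearMap.comp_apply, LinearEquiv.coe_coe, LinearEquiv.symm_apply_apply] at h1
    have h2 : g (a i) = m := h1
    apply hmF
    rw [← h2, ← mul_one (a i), ← _root_.smul_eq_mul, map_smul]
    exact (F i).smul_mem _ hgi

/-- Limit models of different regular lengths, the smaller of which is below `γ(R)`, are not
isomorphic. -/
theorem IsLimitModel.not_nonempty_linearEquiv {N : Type u} [AddCommGroup N] [Module R N]
    {μ κ ν : Cardinal.{u}} (hM : IsLimitModel R μ κ.ord M) (hN : IsLimitModel R μ ν.ord N)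
    (hR : #R ≤ μ) (hκ : ℵ₀ ≤ κ) (hκγ : κ < gammaCard R) (hκν : κ < ν) (hν : ν.IsRegular) :
    ¬ Nonempty (M ≃ₗ[R] N) := by
  rintro ⟨e⟩
  obtain ⟨S, hS, f, hf⟩ := hM.exists_not_extension hR hκ hκγ
  obtain ⟨g, hg⟩ := hN.exists_extension_ideal hR (S := S)
    (by rw [hν.cof_ord]; exact hS.trans_lt hκν) (e.toLinearMap ∘ₗ f)
  exact hf ⟨e.symm.toLinearMap ∘ₗ g, fun x => by simp [hg]⟩

end Nonextension

/-! ### Limit models of every length from a single one. -/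

section Existence

variable {R : Type u} [Ring R] {M : Type u} [AddCommGroup M] [Module R M]

/-- Every module embeds into an injective module. -/
theorem exists_embedding_injective (R : Type u) [Ring R] (M : Type u) [AddCommGroup M]
    [Module R M] : ∃ (I : Type u) (_ : AddCommGroup I) (_ : Module R I) (f : M →ₗ[R] I),
      Module.Injective R I ∧ Function.Injective f := by
  obtain ⟨⟨J, hJ, f, hf⟩⟩ :=
    (inferInstance : CategoryTheory.EnoughInjectives (ModuleCat.{u} R)).presentation
      (ModuleCat.of R M)
  exact ⟨J, inferInstance, inferInstance, f.hom,
    (Module.injective_iff_injective_object R J).2 hJ, (ModuleCat.mono_iff_injective f).1 hf⟩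

/-- If there is a `μ`-limit model, then every module of cardinality `μ` has a universal
extension. -/
theorem IsLimitModel.exists_isUniversalOver {μ : Cardinal.{u}} {α : Ordinal.{u}}
    (h : IsLimitModel R μ α M) {N : Type u} [AddCommGroup N] [Module R N] (hN : #N = μ) :
    ∃ (W : Type u) (_ : AddCommGroup W) (_ : Module R W) (ι : N →ₗ[R] W), IsUniversalOver ι := by
  obtain ⟨⟨hμ, hα, hα'⟩, F, hF⟩ := isLimitModel_iff.1 h
  obtain ⟨g, hgF, -, -, hg⟩ := (hF.ext 0 hα.bot_lt).2 PUnit N 0 0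
    (Function.injective_of_subsingleton _) hN.le (fun _ => zero_mem _)
  have hg := hg (Function.injective_of_subsingleton _)
  have h1 := hα.succ_lt hα.bot_lt
  have h12 := hF.ext _ h1
  -- Stage 1 contains a copy of `N`; stage 2 amalgamates every extension of `N` over that copy.
  refine ⟨F (Order.succ (Order.succ 0)), inferInstance, inferInstance,
    g.codRestrict _ fun x => h12.1 (hgF x), fun x y hxy => hg (congrArg Subtype.val hxy),
    (hF.card _ (hα.succ_lt h1)).trans hN.symm, ?_⟩
  intro N' _ _ j hj hN'
  obtain ⟨f, hfC, hf, -, hfi⟩ := h12.2 N N' j g hj (hN'.trans (hF.card _ (hα.succ_lt h1))).le hgF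
  exact ⟨f.codRestrict _ hfC, fun x y hxy => hfi hg (congrArg Subtype.val hxy),
    LinearMap.ext fun x => Subtype.ext (hf x)⟩

/-- A continuous chain of submodules, each universal over the previous one, yields a limit
model. -/
theorem isLimitModel_iSup {μ : Cardinal.{u}} (hμ : ℵ₀ ≤ μ) {α : Ordinal.{u}}
    (hα : Order.IsSuccLimit α) (hα' : α < (Order.succ μ).ord) {x : Ordinal.{u} → Submodule R M}
    (hx : Monotone x) (hcard : ∀ i < α, #(x i) = μ)
    (hlim : ∀ δ, Order.IsSuccLimit δ → x δ = ⨆ j : Set.Iio δ, x j)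
    (hext : ∀ i < α, IsExtensibleIn μ (x i) (x (Order.succ i))) :
    IsLimitModel R μ α (⨆ j : Set.Iio α, x j : Submodule R M) := by
  have hle : ∀ i < α, x i ≤ ⨆ j : Set.Iio α, x j := fun i hi =>
    le_iSup (fun j : Set.Iio α => x j) ⟨i, hi⟩
  refine isLimitModel_iff.2 ⟨⟨hμ, hα, hα'⟩, fun i => (x i).submoduleOf _,
    fun i hi => ?_, fun i j hij hj m hm => hx hij hm, fun i hi hil m hm => ?_, fun m => ?_,
    fun i hi => ⟨fun m hm => (hext i hi).1 hm, ?_⟩⟩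
  · rw [← hcard i hi]
    exact mk_congr (Submodule.submoduleOfEquivOfLe (hle i hi)).toEquiv
  · have hm : (m : M) ∈ x i := hm
    rw [hlim i hil] at hm
    exact (Submodule.mem_iSup_Iio hil.bot_lt fun _ _ hij _ => hx hij).1 hm
  · exact (Submodule.mem_iSup_Iio hα.bot_lt fun _ _ hij _ => hx hij).1 m.2
  · intro A N' _ _ _ _ j g hj hN' hg
    obtain ⟨f, hfC, hf, hfB, hfi⟩ := (hext i hi).2 A N' j (Submodule.subtype _ ∘ₗ g) hj hN' hg
    refine ⟨f.codRestrict _ fun y => hle _ (hα.succ_lt hi) (hfC y), hfC,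
      fun a => Subtype.ext (hf a), hfB, fun hgi y z hyz => ?_⟩
    exact hfi ((Submodule.subtype_injective _).comp hgi) (congrArg Subtype.val hyz)

/-- If there is a `μ`-limit model, then there are `μ`-limit models of all possible lengths. -/
theorem IsLimitModel.exists_isLimitModel {μ : Cardinal.{u}} {α : Ordinal.{u}}
    (h : IsLimitModel R μ α M) {β : Ordinal.{u}} (hβ : Order.IsSuccLimit β)
    (hβ' : β < (Order.succ μ).ord) :
    ∃ (L : Type u) (_ : AddCommGroup L) (_ : Module R L), IsLimitModel R μ β L := by
  classical
  have hμ : ℵ₀ ≤ μ := (isLimitModel_iff.1 h).1.1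
  have hM : #M = μ := by
    obtain ⟨⟨hμ, hα, hα'⟩, F, hF⟩ := isLimitModel_iff.1 h
    exact hF.card_eq hμ hα hα'
  obtain ⟨I, _, _, φ, hI, hφ⟩ := exists_embedding_injective R M
  -- The chain is built inside the fixed module `K → I`, so limits are suprema of submodules. Stage
  -- `i` is supported on coordinates `≤ i`, which leaves coordinate `i + 1` free; `Shrink` lowers
  -- the universe of the index set.
  let K := Shrink.{u} (Set.Iio β)
  let rk : K → Ordinal.{u} := fun k => ((equivShrink (Set.Iio β)).symm k : Ordinal.{u})
  let k : ∀ i, i < β → K := fun i hi => equivShrink (Set.Iio β) ⟨i, hi⟩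
  have hrk : ∀ i hi, rk (k i hi) = i := fun i hi => by simp [rk, k]
  let mask : Ordinal.{u} → (K → I) →ₗ[R] (K → I) := fun i =>
    LinearMap.pi fun l => if rk l ≤ i then LinearMap.proj l else 0
  have hmask : ∀ i f l, mask i f l = if rk l ≤ i then f l else 0 := by
    intro i f l
    by_cases hl : rk l ≤ i <;> simp [mask, hl]
  let e₀ : M →ₗ[R] (K → I) := LinearMap.single R (fun _ => I) (k 0 hβ.bot_lt) ∘ₗ φ
  have he₀ : Function.Injective e₀ := (Pi.single_injective _).comp hφ
  have hstep : ∀ i, Order.succ i < β → ∀ x : Submodule R (K → I),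
      (#x = μ ∧ ∀ f ∈ x, ∀ l, i < rk l → f l = 0) →
      ∃ y, x ≤ y ∧ (#y = μ ∧ ∀ f ∈ y, ∀ l, Order.succ i < rk l → f l = 0) ∧
        IsExtensibleIn μ x y := by
    rintro i hi x ⟨hxc, hx⟩
    obtain ⟨W, _, _, ι, hι⟩ := h.exists_isUniversalOver hxc
    obtain ⟨ψ, hψ⟩ := Module.Injective.out ι hι.1 x.subtype
    have hWc : #W = μ := hι.2.1.trans hxc
    obtain ⟨q, hq⟩ := h.exists_embedding (N := W ⧸ LinearMap.range ι)
      ((mk_le_of_surjective (LinearMap.range ι).mkQ_surjective).trans hWc.le)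
    -- Up to coordinate `i`, `e` extends the inclusion of `x` by injectivity; coordinate `i + 1`
    -- embeds `W` modulo `x`. Hence `e` fixes `x` and is injective.
    let e : W →ₗ[R] (K → I) := mask i ∘ₗ ψ +
      LinearMap.single R (fun _ => I) (k _ hi) ∘ₗ φ ∘ₗ q ∘ₗ (LinearMap.range ι).mkQ
    have hv : ∀ w l, e w l = (if rk l ≤ i then ψ w l else 0) +
        Pi.single (M := fun _ => I) (k _ hi) (φ (q ((LinearMap.range ι).mkQ w))) l := by
      intro w l
      rw [← hmask]; rfl
    have heι : ∀ n, e (ι n) = n := by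
      intro n
      ext l
      have h0 : (LinearMap.range ι).mkQ (ι n) = 0 :=
        (Submodule.Quotient.mk_eq_zero _).2 ⟨n, rfl⟩
      rw [hv, h0, map_zero, map_zero, Pi.single_zero, Pi.zero_apply, add_zero, hψ]
      split_ifs with hl
      · rfl
      · exact (hx n n.2 l (not_le.1 hl)).symm
    have hei : Function.Injective e := by
      rw [← LinearMap.ker_eq_bot, LinearMap.ker_eq_bot']
      intro w hw
      have h1 := hv w (k _ hi)
      rw [hw, hrk, if_neg (Order.lt_succ i).not_ge, Pi.single_eq_same, zero_add, Pi.zero_apply,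
        eq_comm, map_eq_zero_iff φ hφ, map_eq_zero_iff q hq] at h1
      obtain ⟨n, rfl⟩ := (Submodule.Quotient.mk_eq_zero _).1 h1
      rw [heι] at hw
      rw [show n = 0 from Subtype.ext hw, map_zero]
    have hxy : x ≤ LinearMap.range e := fun n hn => ⟨ι ⟨n, hn⟩, heι _⟩
    have hyc : #(LinearMap.range e) = μ :=
      (mk_congr (LinearEquiv.ofInjective e hei).toEquiv).symm.trans hWc
    refine ⟨LinearMap.range e, hxy, ⟨hyc, ?_⟩, .of_isUniversalOver hμ hxc hxy
      ⟨Submodule.inclusion_injective _, hyc.trans hxc.symm, ?_⟩⟩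
    · rintro _ ⟨w, rfl⟩ l hl
      rw [hv, if_neg ((Order.lt_succ i).trans hl).not_ge, zero_add]
      refine Pi.single_eq_of_ne ?_ _
      rintro rfl
      rw [hrk] at hl
      exact hl.false
    · intro N' _ _ j hj hN'
      obtain ⟨f, hfi, hf⟩ := hι.2.2 N' j hj (hN'.trans (hyc.trans hWc.symm))
      refine ⟨(LinearEquiv.ofInjective e hei).toLinearMap ∘ₗ f,
        (LinearEquiv.ofInjective e hei).injective.comp hfi, ?_⟩
      ext n : 1
      refine Subtype.ext ?_
      change e (f (j n)) = n
      rw [show f (j n) = ι n from LinearMap.congr_fun hf n, heι]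
  obtain ⟨x, hmono, -, hP, hQ, hlim⟩ := exists_continuous_chain
    (fun i (x : Submodule R (K → I)) => #x = μ ∧ ∀ f ∈ x, ∀ l, i < rk l → f l = 0)
    (fun _ x y => IsExtensibleIn μ x y) β (LinearMap.range e₀)
    (by
      refine ⟨(mk_congr (LinearEquiv.ofInjective e₀ he₀).toEquiv).symm.trans hM, ?_⟩
      rintro _ ⟨m, rfl⟩ l hl
      refine Pi.single_eq_of_ne ?_ _
      rintro rfl
      rw [hrk] at hl
      exact hl.false)
    hstep
    (by
      intro δ hδ hδl x hx hxP
      have hmem : ∀ y, y ∈ ⨆ j : Set.Iio δ, x j ↔ ∃ j < δ, y ∈ x j := fun y =>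
        Submodule.mem_iSup_Iio hδl.bot_lt fun _ _ hij _ => hx hij
      refine ⟨le_antisymm ?_ ?_, fun f hf l hl => ?_⟩
      · have hU : ((⨆ j : Set.Iio δ, x j : Submodule R (K → I)) : Set (K → I)) =
            ⋃ j : Set.Iio δ, (x j : Set (K → I)) := by
          ext y
          rw [SetLike.mem_coe, hmem]
          simp
        change #((⨆ j : Set.Iio δ, x j : Submodule R (K → I)) : Set (K → I)) ≤ μ
        rw [hU]
        exact mk_iUnion_Iio_le hμ (hδ.trans hβ') (fun i => (x i : Set (K → I)))
          fun i hi => (hxP i hi).1.le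
      · rw [← (hxP 0 hδl.bot_lt).1]
        exact mk_le_of_injective (Submodule.inclusion_injective
          (le_iSup (fun j : Set.Iio δ => x j) ⟨0, hδl.bot_lt⟩))
      · obtain ⟨j, hj, hf⟩ := (hmem f).1 hf
        exact (hxP j hj).2 f hf l (hj.trans hl))
  exact ⟨_, inferInstance, inferInstance, isLimitModel_iSup hμ hβ hβ' hmono
    (fun i hi => (hP i hi).1) hlim fun i hi => hQ i (hβ.succ_lt hi)⟩

end Existence

/-! ### The set of lengths and the main theorem. -/

theorem isRegular_of_mem_limitLengths {R : Type u} [Ring R] {κ : Cardinal.{u}}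
    (hκ : κ ∈ limitLengths R) : κ.IsRegular := by
  rcases hκ with ⟨-, hκ⟩ | rfl
  · exact hκ
  · exact isRegular_succ (gammaCard_spec R).1

theorem le_succ_gammaCard_of_mem_limitLengths {R : Type u} [Ring R] {κ : Cardinal.{u}}
    (hκ : κ ∈ limitLengths R) : κ ≤ Order.succ (gammaCard R) := by
  rcases hκ with ⟨hκ, -⟩ | rfl
  · exact hκ.2.le.trans (Order.le_succ _)
  · exact le_rfl

/-- `γ(R)⁺` is the largest length, so the smaller of two lengths lies below `γ(R)`. -/
theorem lt_gammaCard_of_lt_of_mem_limitLengths {R : Type u} [Ring R] {κ ν : Cardinal.{u}}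
    (hκ : κ ∈ limitLengths R) (hν : ν ∈ limitLengths R) (h : κ < ν) : κ < gammaCard R := by
  rcases hκ with ⟨hκ, -⟩ | rfl
  · exact hκ.2
  · exact absurd (le_succ_gammaCard_of_mem_limitLengths hν) h.not_ge

theorem lemma3p22 (R : Type u) [Ring R] (μ : Cardinal.{u})
    (hcard : #R ≤ μ) (hγ : Order.succ (gammaCard R) ≤ μ) (hst : IsStableIn R μ) :
    -- for each length in the set, the limit model exists and is unique up to isomorphism
    (∀ α ∈ limitLengths R,
      (∃ (M : Type u) (_ : AddCommGroup M) (_ : Module R M), IsLimitModel R μ α.ord M) ∧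
      ∀ (M N : Type u) [AddCommGroup M] [Module R M] [AddCommGroup N] [Module R N],
        IsLimitModel R μ α.ord M → IsLimitModel R μ α.ord N → Nonempty (M ≃ₗ[R] N)) ∧
    -- limit models of distinct lengths in the set are not isomorphic
    (∀ α ∈ limitLengths R, ∀ β ∈ limitLengths R, α ≠ β →
      ∀ (M N : Type u) [AddCommGroup M] [Module R M] [AddCommGroup N] [Module R N],
        IsLimitModel R μ α.ord M → IsLimitModel R μ β.ord N → ¬ Nonempty (M ≃ₗ[R] N)) ∧
    -- every limit model is isomorphic to one of these
    (∀ (L : Type u) [AddCommGroup L] [Module R L], IsCardLimitModel R μ L →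
      ∃ α ∈ limitLengths R, ∃ (M : Type u) (_ : AddCommGroup M) (_ : Module R M),
        IsLimitModel R μ α.ord M ∧ Nonempty (L ≃ₗ[R] M)) := by
  obtain ⟨L₀, _, _, α₀, hL₀⟩ := hst
  have hex : ∀ α ∈ limitLengths R,
      ∃ (M : Type u) (_ : AddCommGroup M) (_ : Module R M), IsLimitModel R μ α.ord M :=
    fun α hα => hL₀.exists_isLimitModel
      (isSuccLimit_ord (isRegular_of_mem_limitLengths hα).aleph0_le)
      (ord_lt_ord.2 (Order.lt_succ_iff.2
        ((le_succ_gammaCard_of_mem_limitLengths hα).trans hγ)))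
  have hlt : ∀ α ∈ limitLengths R, ∀ β ∈ limitLengths R, α < β →
      ∀ (M N : Type u) [AddCommGroup M] [Module R M] [AddCommGroup N] [Module R N],
        IsLimitModel R μ α.ord M → IsLimitModel R μ β.ord N → ¬ Nonempty (M ≃ₗ[R] N) := by
    intro α hα β hβ h M N _ _ _ _ hM hN
    exact hM.not_nonempty_linearEquiv hN hcard (isRegular_of_mem_limitLengths hα).aleph0_le
      (lt_gammaCard_of_lt_of_mem_limitLengths hα hβ h) h (isRegular_of_mem_limitLengths hβ)
  refine ⟨fun α hα => ⟨hex α hα, fun M N _ _ _ _ hM hN => hM.nonempty_linearEquiv hN⟩,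
    fun α hα β hβ hne M N _ _ _ _ hM hN => ?_, fun L _ _ => ?_⟩
  · rcases hne.lt_or_gt with h | h
    · exact hlt α hα β hβ h M N hM hN
    · rintro ⟨e⟩
      exact hlt β hβ α hα h N M hN hM ⟨e.symm⟩
  · rintro ⟨α, hL⟩
    have hα : Order.IsSuccLimit α := (isLimitModel_iff.1 hL).1.2.1
    -- The second case includes `cof α = γ(R)`, so a regular `γ(R)` gives no class of its own.
    rcases lt_or_ge α.cof (gammaCard R) with h | h
    · exact ⟨α.cof, .inl ⟨⟨aleph0_le_cof_iff.2 (one_lt_cof_iff.2 hα), h⟩,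
        isRegular_cof hα⟩, L, _, _, hL.cof_ord, ⟨.refl R L⟩⟩
    · obtain ⟨M, _, _, hM⟩ := hex _ (.inr rfl)
      refine ⟨_, .inr rfl, M, _, _, hM, hL.nonempty_linearEquiv_of_gammaCard_le hM hcard h ?_⟩
      rw [(isRegular_succ (gammaCard_spec R).1).cof_ord]
      exact Order.le_succ _
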